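/- Let $K$ be an algebraically closed field that is complete with respect to a nontrivial non-Archimedean absolute value $|\cdot|$, and let $p>1$ be the base of the logarithms (for $K=\mathbb{C}_p$, the prime $p$). An open ball of $\mathbb{P}^1=\mathbb{P}^1(K)$ is a usual open ball $B(a,r)=\{x\in K:|x-a|<r\}$, $r>0$, or the complement of a usual closed ball $B(a,r)^+=\{x\in K:|x-a|\le r\}$; the corresponding closed ball $B^+$ is $B(a,r)^+$, respectively $\mathbb{P}^1\setminus B(a,r)$. Let $\gamma_1,\dots,\gamma_g\in PGL(2,K)$ generate a Schottky group $\Gamma$ and be in good position: there are $2g$ open balls $B_1,\dots,B_g,B_1',\dots,B_g'$ of $\mathbb{P}^1$ whose corresponding closed balls are pairwise disjoint and which satisfy $\gamma_i(\mathbb{P}^1\setminus B_i')=B_i^+$ and $\gamma_i^{-1}(\mathbb{P}^1\setminus B_i)=B_i'^+$ for all $i$. Let $F$ be the complement of the union of these $2g$ open balls, and assume that $\infty$ lies in the interior of $F$, that is, in none of the $2g$ closed balls. Then all these balls are usual balls. Let $d$ be the minimum of the diameters of $B_1,\dots,B_g,B_1',\dots,B_g'$, and let $c$ be the minimum of the pairwise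 distances between the $2g$ points $P_1,\dots,P_g,P_1',\dots,P_g'$ of $(\mathbb{P}^1)^{an}$ given by the corresponding closed balls, where the distance between the points given by $B(a_1,r_1)^+$ and $B(a_2,r_2)^+$ is $\log_p(R/r_1)+\log_p(R/r_2)$, with $R=\max\{r_1,r_2,|a_1-a_2|\}$ the radius of the smallest closed ball containing both. Let $\Gamma_m$ be the set of elements of $\Gamma$ that are products of reduced words of length at most $m$ in $\gamma_1^{\pm1},\dots,\gamma_g^{\pm1}$. Fix $i$, let $a\in B_i'^+\setminus B_i'$, and put $$u_{\gamma_i}(w)=\prod_{\gamma\in\Gamma}\frac{w-\gamma a}{w-\gamma\gamma_i a}.$$ Let $z\in F\cap K$ with $z\notin\Gamma a$, and let $m\ge 1$ be an integer. Then $\gamma a\ne\infty$ for all $\gamma\in\Gamma$, the product $u_{\gamma_i}(w)$ converges for all $w$ near $z$, $u_{\gamma_i}$ is differentiable at $z$ with $u_{\gamma_i}(z)\neq 0$, and $$\left|\sum_{\gamma\in\Gamma_m}\frac{\gamma a-\gamma\gamma_i a}{(z-\gamma a)(z-\gamma\gamma_i a)}-\frac{u_{\gamma_i}'(z)}{u_{\gamma_i}(z)}\right|\le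 p^{-mc-\log_p(d)}.$$ -/

import Mathlib

open OnePoint Topology
open scoped MatrixGroups

namespace MumfordCurve

section Defs

variable {K : Type*} [NontriviallyNormedField K]

/-- An open ball of `ℙ¹(K) = K ∪ {∞}`, presented by a centre and a positive radius: either a usual
open ball `B(a, r)` (`disc`), or the complement of a usual closed ball `B(a, r)⁺` (`codisc`). -/
inductive ProjBall (K : Type*) where
  | disc (a : K) (r : ℝ) (hr : 0 < r)
  | codisc (a : K) (r : ℝ) (hr : 0 < r)

/-- The centre of the presentation of a ball. -/
def ProjBall.center : ProjBall K → K
  | disc a _ _ => a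
  | codisc a _ _ => a

/-- The radius of the presentation of a ball. -/
def ProjBall.radius : ProjBall K → ℝ
  | disc _ r _ => r
  | codisc _ r _ => r

/-- The open ball `B ⊆ ℙ¹(K)`. -/
def ProjBall.openBall : ProjBall K → Set (OnePoint K)
  | disc a r _ => (fun x : K => (x : OnePoint K)) '' Metric.ball a r
  | codisc a r _ => ((fun x : K => (x : OnePoint K)) '' Metric.closedBall a r)ᶜ

/-- The closed ball `B⁺ ⊆ ℙ¹(K)` corresponding to the open ball `B`. -/
def ProjBall.closedBall : ProjBall K → Set (OnePoint K)
  | disc a r _ => (fun x : K => (x : OnePoint K)) '' Metric.closedBall a r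
  | codisc a r _ => ((fun x : K => (x : OnePoint K)) '' Metric.ball a r)ᶜ

/-- The diameter of the part of the open ball `B` that lies in `K`. It is the diameter of `B` when
`∞ ∉ B`, the only case in which it is used. -/
noncomputable def ProjBall.diam (B : ProjBall K) : ℝ :=
  Metric.diam {x : K | (x : OnePoint K) ∈ B.openBall}

/-- The distance, in the tree of closed balls of `K` with base-`p` logarithmic lengths, between the
points given by the closed balls of `K` with the centres and radii of `B₁` and `B₂`. The smallest
closed ball containing both of them has radius `R = max (max r₁ r₂) ‖a₁ - a₂‖`, and the distance is
the length `logₚ (R / r₁)` of the path up from the first to that ball plus the length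
`logₚ (R / r₂)` of the path down to the second. -/
noncomputable def ProjBall.treeDist (p : ℝ) (B₁ B₂ : ProjBall K) : ℝ :=
  let R := max (max B₁.radius B₂.radius) ‖B₁.center - B₂.center‖
  Real.logb p (R / B₁.radius) + Real.logb p (R / B₂.radius)

/-- The family of the `2g` balls `B₁, …, B_g, B₁', …, B_g'`. -/
def allBalls {g : ℕ} (B B' : Fin g → ProjBall K) : Fin g ⊕ Fin g → ProjBall K :=
  Sum.elim B B'

/-- The domain `F`: the complement in `ℙ¹(K)` of the `2g` open balls. -/
def domain {g : ℕ} (B B' : Fin g → ProjBall K) : Set (OnePoint K) :=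
  (⋃ j, (allBalls B B' j).openBall)ᶜ

/-- The interior `F°`: the complement in `ℙ¹(K)` of the `2g` closed balls. -/
def domainInterior {g : ℕ} (B B' : Fin g → ProjBall K) : Set (OnePoint K) :=
  (⋃ j, (allBalls B B' j).closedBall)ᶜ

/-- The group `Γ` generated by the `γ i`. -/
def grp {g : ℕ} (γ : Fin g → PGL(2, K)) : Subgroup PGL(2, K) :=
  Subgroup.closure (Set.range γ)

/-- The element of the group given by a letter: `(i, true)` is `γᵢ`, and `(i, false)` is `γᵢ⁻¹`. -/
def letter {g : ℕ} (γ : Fin g → PGL(2, K)) (x : Fin g × Bool) : PGL(2, K) :=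
  if x.2 then γ x.1 else (γ x.1)⁻¹

/-- The set `Γₘ` of the products of the reduced words of length at most `m` in the `γᵢ^{±1}`. -/
def wordSet {g : ℕ} (γ : Fin g → PGL(2, K)) (m : ℕ) : Set PGL(2, K) :=
  {δ | ∃ w : List (Fin g × Bool),
    FreeGroup.IsReduced w ∧ w.length ≤ m ∧ (w.map (letter γ)).prod = δ}

theorem wordSet_finite {g : ℕ} (γ : Fin g → PGL(2, K)) (m : ℕ) : (wordSet γ m).Finite := by
  refine ((List.finite_length_le (Fin g × Bool) m).image
    fun w => (w.map (letter γ)).prod).subset ?_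
  rintro δ ⟨w, -, hw, rfl⟩
  exact ⟨w, hw, rfl⟩

variable [DecidableEq K]

/-- `PGL(2, K)` acts on `ℙ¹(K)` by fractional linear transformations, through the action of
`GL(2, K)`. -/
noncomputable instance instPGLAction : MulAction PGL(2, K) (OnePoint K) :=
  Matrix.ProjGenLinGroup.mulActionOfGL (by
    intro u x
    induction x using OnePoint.rec with
    | infty => simp [OnePoint.smul_infty_eq_ite]
    | coe x =>
      have hu : (u : K) ≠ 0 := u.ne_zero
      simp [OnePoint.smul_some_eq_ite, hu])

/-- The complement of the open balls `B i`, `B' i` is a good fundamental domain corresponding to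
the elements `γ i`. -/
structure IsGoodFundamentalDomain {g : ℕ} (γ : Fin g → PGL(2, K)) (B B' : Fin g → ProjBall K) :
    Prop where
  /-- The `2g` closed balls are pairwise disjoint. -/
  disjoint : Pairwise fun j k =>
    Disjoint (allBalls B B' j).closedBall (allBalls B B' k).closedBall
  /-- `γᵢ (ℙ¹ \ Bᵢ') = Bᵢ⁺`. -/
  image : ∀ i, (fun x => γ i • x) '' ((B' i).openBall)ᶜ = (B i).closedBall
  /-- `γᵢ⁻¹ (ℙ¹ \ Bᵢ) = Bᵢ'⁺`. -/
  image_inv : ∀ i, (fun x => (γ i)⁻¹ • x) '' ((B i).openBall)ᶜ = (B' i).closedBall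

/-- The affine coordinate of a point of `ℙ¹(K)` other than `∞` (and `0` at `∞`). -/
def coord (x : OnePoint K) : K :=
  OnePoint.elim x 0 id

/-- The factor `(w - δa) / (w - δb)` of the theta function. -/
noncomputable def thetaFactor (a b : OnePoint K) (w : K) (δ : PGL(2, K)) : K :=
  (w - coord (δ • a)) / (w - coord (δ • b))

/-- The theta function `Θ(a, b; w) = ∏_{δ ∈ Γ} (w - δa) / (w - δb)`. -/
noncomputable def theta {g : ℕ} (γ : Fin g → PGL(2, K)) (a b : OnePoint K) (w : K) : K :=
  ∏' δ : grp γ, thetaFactor a b w δ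

/-- The function `u_α(w) = Θ(a, αa; w)`, formed with the base point `a`. -/
noncomputable def uFun {g : ℕ} (γ : Fin g → PGL(2, K)) (α : PGL(2, K)) (a : OnePoint K) (w : K) :
    K :=
  theta γ a (α • a) w

/-- The sum over `δ ∈ Γₘ` of `(δa - δαa) / ((w - δa) (w - δαa))`. -/
noncomputable def truncatedSum {g : ℕ} (γ : Fin g → PGL(2, K)) (m : ℕ) (α : PGL(2, K))
    (a : OnePoint K) (w : K) : K :=
  ∑ δ ∈ (wordSet_finite γ m).toFinset,
    (coord (δ • a) - coord (δ • α • a)) / ((w - coord (δ • a)) * (w - coord (δ • α • a)))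

end Defs

end MumfordCurve

/-! The logarithmic derivative of the product may be taken termwise, so `u'/u` at `z` is the sum
over all of `Γ` of the terms that `truncatedSum` adds up over `Γₘ`. The error is therefore the sum
over `δ ∉ Γₘ`, and by the ultrametric inequality it suffices to bound each such term by `q ^ m / d`,
where `q = p ^ (-c)`.

Write such a `δ` as a reduced word; it has more than `m` letters. If `s` is its first letter and `r`
the radius of the ball of `s`, then ping-pong puts `δa` and `δγᵢa` in that open ball, which does not
contain `z`. Both factors of the denominator thus have norm at least `r`. The numerator is at most
`r * q ^ m`: a letter is a map `A + κ / (x - P)`, and the radii it introduces telescope along the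
word, leaving for each adjacent pair of letters a factor `r₁ r₂ / R² = p ^ (-dist) ≤ q`
(`PingPong.norm_sub_le`, `PingPong.exists_smul_eq`, `radius_mul_div_le_rpow`). The quotient is at
most `q ^ m / r ≤ q ^ m / d`.

The same estimate makes `δa - δγᵢa` tend to zero along `Γ`. Over a complete ultrametric field this
gives convergence, nonvanishing and differentiability (`hasDerivAt_tprod_div_of_tendsto`). -/

namespace MumfordCurve

/-! ### Infinite products over a complete ultrametric field. -/

section Ultrametric

open Filter

variable {K : Type*} [NontriviallyNormedField K] {ι : Type*}

theorem exists_finset_norm_le_of_tendsto_cofinite {f : ι → K} (hf : Tendsto f cofinite (𝓝 0))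
    {ε : ℝ} (hε : 0 < ε) : ∃ s : Finset ι, ∀ i ∉ s, ‖f i‖ ≤ ε := by
  have h : ∀ᶠ i in cofinite, ‖f i‖ ≤ ε := by
    filter_upwards [hf (Metric.closedBall_mem_nhds 0 hε)] with i hi
    simpa using hi
  refine ⟨(eventually_cofinite.1 h).toFinset, fun i hi => ?_⟩
  simpa using hi

variable [IsUltrametricDist K]

theorem norm_add_le_of_le {x y : K} {C : ℝ} (hx : ‖x‖ ≤ C) (hy : ‖y‖ ≤ C) : ‖x + y‖ ≤ C :=
  (IsUltrametricDist.norm_add_le_max x y).trans (max_le hx hy)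

theorem norm_sub_le_of_mem_closedBall {a x y : K} {r : ℝ} (hx : x ∈ Metric.closedBall a r)
    (hy : y ∈ Metric.closedBall a r) : ‖x - y‖ ≤ r := by
  rw [← sub_add_sub_cancel x a y]
  rw [mem_closedBall_iff_norm] at hx
  rw [mem_closedBall_iff_norm'] at hy
  exact norm_add_le_of_le hx hy

theorem norm_prod_one_add_sub_one_le (s : Finset ι) (f : ι → K) {ε : ℝ} (hε : ε ≤ 1)
    (h0 : 0 ≤ ε) (hf : ∀ i ∈ s, ‖f i‖ ≤ ε) : ‖∏ i ∈ s, (1 + f i) - 1‖ ≤ ε := by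
  classical
  induction s using Finset.induction_on with
  | empty => simpa using h0
  | insert a s ha ih =>
    rw [Finset.prod_insert ha]
    have h1 := hf a (Finset.mem_insert_self a s)
    have h2 := ih fun i hi => hf i (Finset.mem_insert_of_mem hi)
    rw [show (1 + f a) * ∏ i ∈ s, (1 + f i) - 1 =
      (∏ i ∈ s, (1 + f i) - 1) + (f a + f a * (∏ i ∈ s, (1 + f i) - 1)) by ring]
    refine norm_add_le_of_le h2 (norm_add_le_of_le h1 ?_)
    rw [norm_mul]
    exact (mul_le_of_le_one_right (norm_nonneg _) (h2.trans hε)).trans h1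

/-- Every monomial left after expanding contains at least two of the `f i`. This second-order bound
is what yields the derivative of the infinite product. -/
theorem norm_prod_one_add_sub_one_sub_sum_le (s : Finset ι) (f : ι → K) {ε : ℝ} (hε : ε ≤ 1)
    (h0 : 0 ≤ ε) (hf : ∀ i ∈ s, ‖f i‖ ≤ ε) :
    ‖∏ i ∈ s, (1 + f i) - 1 - ∑ i ∈ s, f i‖ ≤ ε ^ 2 := by
  classical
  induction s using Finset.induction_on with
  | empty => simpa using sq_nonneg ε
  | insert a s ha ih =>
    rw [Finset.prod_insert ha, Finset.sum_insert ha]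
    have h1 := hf a (Finset.mem_insert_self a s)
    have hs : ∀ i ∈ s, ‖f i‖ ≤ ε := fun i hi => hf i (Finset.mem_insert_of_mem hi)
    rw [show (1 + f a) * ∏ i ∈ s, (1 + f i) - 1 - (f a + ∑ i ∈ s, f i) =
      (∏ i ∈ s, (1 + f i) - 1 - ∑ i ∈ s, f i) + f a * (∏ i ∈ s, (1 + f i) - 1) by ring]
    refine norm_add_le_of_le (ih hs) ?_
    rw [norm_mul, sq]
    exact mul_le_mul h1 (norm_prod_one_add_sub_one_le s f hε h0 hs) (norm_nonneg _) h0

theorem norm_eq_one_of_norm_sub_one_lt {x : K} (h : ‖x - 1‖ < 1) : ‖x‖ = 1 := by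
  have := IsUltrametricDist.norm_add_eq_max_of_norm_ne_norm (x := x - 1) (y := 1)
    (by rw [norm_one]; exact h.ne)
  rw [sub_add_cancel, norm_one, max_eq_right h.le] at this
  exact this

/-- The norms of the partial products are eventually constant. -/
theorem exists_finset_norm_prod_one_add_eq {f : ι → K} (hf : Tendsto f cofinite (𝓝 0)) :
    ∃ s : Finset ι, ∀ t, s ⊆ t → ‖∏ i ∈ t, (1 + f i)‖ = ‖∏ i ∈ s, (1 + f i)‖ := by
  classical
  -- Any bound below `1` would do: a product of further factors is then within that bound of `1`,
  -- hence of norm `1`.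
  obtain ⟨s, hs⟩ := exists_finset_norm_le_of_tendsto_cofinite hf (ε := 1 / 2) (by norm_num)
  refine ⟨s, fun t hst => ?_⟩
  rw [← Finset.prod_sdiff hst, norm_mul, norm_eq_one_of_norm_sub_one_lt, one_mul]
  refine (norm_prod_one_add_sub_one_le _ f (ε := 1 / 2) (by norm_num) (by norm_num)
    fun i hi => hs i (Finset.mem_sdiff.1 hi).2).trans_lt (by norm_num)

theorem multipliable_one_add_of_tendsto_cofinite [CompleteSpace K] {f : ι → K}
    (hf : Tendsto f cofinite (𝓝 0)) : Multipliable fun i => 1 + f i := by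
  classical
  obtain ⟨s, hs⟩ := exists_finset_norm_prod_one_add_eq hf
  suffices h : CauchySeq fun t : Finset ι => ∏ i ∈ t, (1 + f i) by
    obtain ⟨x, hx⟩ := cauchySeq_tendsto_of_complete h
    exact ⟨x, hx⟩
  refine Metric.cauchySeq_iff'.2 fun ε hε => ?_
  -- The summand `1` keeps `C` positive even when a factor in `s` vanishes.
  set C := ‖∏ i ∈ s, (1 + f i)‖ + 1 with hC
  have hC0 : 0 < C := by positivity
  obtain ⟨s', hs'⟩ := exists_finset_norm_le_of_tendsto_cofinite hf
    (ε := min 1 (ε / C / 2)) (by positivity)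
  refine ⟨s ∪ s', fun t ht => ?_⟩
  rw [dist_eq_norm, ← Finset.prod_sdiff ht, ← sub_one_mul, norm_mul,
    hs _ Finset.subset_union_left]
  have h1 := norm_prod_one_add_sub_one_le (t \ (s ∪ s')) f (ε := min 1 (ε / C / 2))
    (min_le_left _ _) (by positivity) fun i hi => hs' i fun h =>
      (Finset.mem_sdiff.1 hi).2 (Finset.mem_union_right _ h)
  calc _ ≤ (ε / C / 2) * C := by
        refine mul_le_mul (h1.trans (min_le_right _ _)) (by linarith) (norm_nonneg _)
          (by positivity)
    _ = ε / 2 := by field_simp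
    _ < ε := by linarith

theorem tprod_one_add_ne_zero_of_tendsto_cofinite [CompleteSpace K] {f : ι → K}
    (hf : Tendsto f cofinite (𝓝 0)) (h0 : ∀ i, 1 + f i ≠ 0) : ∏' i, (1 + f i) ≠ 0 := by
  obtain ⟨s, hs⟩ := exists_finset_norm_prod_one_add_eq hf
  have h2 : ‖∏' i, (1 + f i)‖ = ‖∏ i ∈ s, (1 + f i)‖ := by
    refine tendsto_nhds_unique
      (multipliable_one_add_of_tendsto_cofinite hf).hasProd.norm ?_
    refine tendsto_const_nhds.congr' ?_
    filter_upwards [eventually_ge_atTop s] with t ht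
    rw [← hs t ht, norm_prod]
  rw [← norm_ne_zero_iff, h2, norm_ne_zero_iff]
  exact Finset.prod_ne_zero_iff.2 fun i _ => h0 i

theorem norm_tprod_one_add_sub_one_sub_tsum_le [CompleteSpace K] {f : ι → K}
    (hf : Tendsto f cofinite (𝓝 0)) {ε : ℝ} (hε : ε ≤ 1) (h0 : 0 ≤ ε) (hfε : ∀ i, ‖f i‖ ≤ ε) :
    ‖∏' i, (1 + f i) - 1 - ∑' i, f i‖ ≤ ε ^ 2 := by
  have h1 := (multipliable_one_add_of_tendsto_cofinite hf).hasProd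
  have h2 := (NonarchimedeanAddGroup.summable_of_tendsto_cofinite_zero hf).hasSum
  have h3 : Tendsto (fun s => ∏ i ∈ s, (1 + f i) - 1 - ∑ i ∈ s, f i) atTop
      (𝓝 (∏' i, (1 + f i) - 1 - ∑' i, f i)) := (h1.sub_const 1).sub h2
  exact le_of_tendsto h3.norm (.of_forall fun s =>
    norm_prod_one_add_sub_one_sub_sum_le s f hε h0 fun i _ => hfε i)

end Ultrametric

/-! ### Convergence and logarithmic derivative of `∏ (w - xᵢ) / (w - yᵢ)`. -/

section ThetaAnalysis

open Filter

variable {K : Type*} [NontriviallyNormedField K] {ι : Type*} {x y : ι → K} {z w : K} {ρ : ℝ}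

theorem tendsto_div_cofinite_zero {v : ι → K} (hxy : Tendsto (fun i => x i - y i) cofinite (𝓝 0))
    (hρ : 0 < ρ) (hv : ∀ i, ρ ≤ ‖v i‖) :
    Tendsto (fun i => (x i - y i) / v i) cofinite (𝓝 0) := by
  rw [tendsto_zero_iff_norm_tendsto_zero] at hxy ⊢
  refine squeeze_zero (fun _ => norm_nonneg _) (fun i => ?_)
    (by simpa using hxy.div_const ρ)
  rw [norm_div]
  exact div_le_div_of_nonneg_left (norm_nonneg _) hρ (hv i)

variable [IsUltrametricDist K]

theorem norm_sub_eq_of_mem_ball (hw : w ∈ Metric.ball z ρ) {u : K} (hu : ρ ≤ ‖z - u‖) :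
    ‖w - u‖ = ‖z - u‖ := by
  have h : ‖w - z‖ < ‖z - u‖ := lt_of_lt_of_le (by simpa [dist_eq_norm] using hw) hu
  have := IsUltrametricDist.norm_add_eq_max_of_norm_ne_norm h.ne
  rwa [sub_add_sub_cancel, max_eq_right h.le] at this

theorem multipliable_div_of_tendsto [CompleteSpace K]
    (hxy : Tendsto (fun i => x i - y i) cofinite (𝓝 0)) (hρ : 0 < ρ)
    (hy : ∀ i, ρ ≤ ‖z - y i‖) (hw : w ∈ Metric.ball z ρ) :
    Multipliable fun i => (w - x i) / (w - y i) := by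
  have hyw : ∀ i, ρ ≤ ‖w - y i‖ := fun i => by rw [norm_sub_eq_of_mem_ball hw (hy i)]; exact hy i
  have h : ∀ i, (w - x i) / (w - y i) = 1 + -((x i - y i) / (w - y i)) := fun i => by
    have : w - y i ≠ 0 := norm_pos_iff.1 (hρ.trans_le (hyw i))
    field_simp
    ring
  simp_rw [h]
  exact multipliable_one_add_of_tendsto_cofinite
    (by simpa using (tendsto_div_cofinite_zero hxy hρ hyw).neg)

theorem tprod_div_ne_zero_of_tendsto [CompleteSpace K]
    (hxy : Tendsto (fun i => x i - y i) cofinite (𝓝 0)) (hρ : 0 < ρ)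
    (hx : ∀ i, ρ ≤ ‖z - x i‖) (hy : ∀ i, ρ ≤ ‖z - y i‖) :
    ∏' i, (z - x i) / (z - y i) ≠ 0 := by
  have h : ∀ i, (z - x i) / (z - y i) = 1 + -((x i - y i) / (z - y i)) := fun i => by
    have : z - y i ≠ 0 := norm_pos_iff.1 (hρ.trans_le (hy i))
    field_simp
    ring
  simp_rw [h]
  refine tprod_one_add_ne_zero_of_tendsto_cofinite
    (by simpa using (tendsto_div_cofinite_zero hxy hρ hy).neg) fun i => ?_
  rw [← h]
  exact div_ne_zero (norm_pos_iff.1 (hρ.trans_le (hx i))) (norm_pos_iff.1 (hρ.trans_le (hy i)))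

/-- Dividing the product at `w` by the one at `z` gives `∏ (1 + (w - z) fᵢ)` with `fᵢ = (xᵢ - yᵢ) /
((w - yᵢ) (z - xᵢ))`. Up to an error quadratic in `w - z` this is `1 + (w - z) ∑ fᵢ`, and `∑ fᵢ`
differs from its value at `w = z` by `O(w - z)`. -/
theorem hasDerivAt_tprod_div_of_tendsto [CompleteSpace K]
    (hxy : Tendsto (fun i => x i - y i) cofinite (𝓝 0)) (hρ : 0 < ρ)
    (hx : ∀ i, ρ ≤ ‖z - x i‖) (hy : ∀ i, ρ ≤ ‖z - y i‖) :
    HasDerivAt (fun w => ∏' i, (w - x i) / (w - y i))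
      ((∏' i, (z - x i) / (z - y i)) * ∑' i, (x i - y i) / ((z - x i) * (z - y i))) z := by
  obtain ⟨N, hN⟩ := hxy.norm.bddAbove_range_of_cofinite
  replace hN : ∀ i, ‖x i - y i‖ ≤ max N 0 := fun i =>
    (hN (Set.mem_range_self i)).trans (le_max_left _ _)
  set M := max N 0 / (ρ * ρ) with hM
  have hM0 : 0 ≤ M := by positivity
  set u := ∏' i, (z - x i) / (z - y i) with hu
  set T := ∑' i, (x i - y i) / ((z - x i) * (z - y i)) with hT
  have hzx : ∀ i, z - x i ≠ 0 := fun i => norm_pos_iff.1 (hρ.trans_le (hx i))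
  have hzy : ∀ i, z - y i ≠ 0 := fun i => norm_pos_iff.1 (hρ.trans_le (hy i))
  -- The radius `ρ` keeps `‖w - yᵢ‖` equal to `‖z - yᵢ‖`; the radius `1 / (M + 1)` gives `‖w - z‖ *
  -- M ≤ 1`, as the second-order product estimate requires.
  have key : ∀ w ∈ Metric.ball z (min ρ (1 / (M + 1))),
      ‖(∏' i, (w - x i) / (w - y i)) - u - (w - z) * (u * T)‖ ≤
        ‖u‖ * (M ^ 2 + M / ρ) * ‖w - z‖ ^ 2 := by
    intro w hw
    have hwρ : w ∈ Metric.ball z ρ := Metric.ball_subset_ball (min_le_left _ _) hw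
    have hwM : ‖w - z‖ * M ≤ 1 := by
      have : ‖w - z‖ < 1 / (M + 1) := by
        have := Metric.ball_subset_ball (min_le_right _ _) hw
        simpa [dist_eq_norm] using this
      rw [lt_div_iff₀ (by positivity)] at this
      nlinarith [norm_nonneg (w - z)]
    have hyw : ∀ i, ‖w - y i‖ = ‖z - y i‖ := fun i => norm_sub_eq_of_mem_ball hwρ (hy i)
    have hwy : ∀ i, w - y i ≠ 0 := fun i => by
      rw [← norm_pos_iff, hyw]; exact hρ.trans_le (hy i)
    set f : ι → K := fun i => (x i - y i) / ((w - y i) * (z - x i)) with hf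
    have hden : ∀ i, ρ * ρ ≤ ‖(w - y i) * (z - x i)‖ := fun i => by
      rw [norm_mul, hyw]
      exact mul_le_mul (hy i) (hx i) hρ.le (norm_nonneg _)
    have hden' : ∀ i, ρ * ρ ≤ ‖(z - x i) * (z - y i)‖ := fun i => by
      rw [norm_mul]
      exact mul_le_mul (hx i) (hy i) hρ.le (norm_nonneg _)
    have hf0 : Tendsto f cofinite (𝓝 0) := tendsto_div_cofinite_zero hxy (mul_pos hρ hρ) hden
    have hf0' : Tendsto (fun i => (w - z) * f i) cofinite (𝓝 0) := by
      simpa using hf0.const_mul (w - z)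
    have hfM : ∀ i, ‖f i‖ ≤ M := fun i => by
      rw [hf, norm_div]
      exact div_le_div₀ (le_max_right _ _) (hN i) (mul_pos hρ hρ) (hden i)
    have hprod : ∏' i, (w - x i) / (w - y i) = u * ∏' i, (1 + (w - z) * f i) := by
      rw [hu, ← (multipliable_div_of_tendsto hxy hρ hy (Metric.mem_ball_self hρ)).tprod_mul
        (multipliable_one_add_of_tendsto_cofinite hf0')]
      refine tprod_congr fun i => ?_
      have h1 := hzx i
      have h2 := hzy i
      have h3 := hwy i
      simp only [hf]
      field_simp
      ring
    have hsum : ∑' i, (w - z) * f i = (w - z) * ∑' i, f i := tsum_mul_left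
    have h1 : ‖∏' i, (1 + (w - z) * f i) - 1 - (w - z) * ∑' i, f i‖ ≤ (‖w - z‖ * M) ^ 2 := by
      rw [← hsum]
      refine norm_tprod_one_add_sub_one_sub_tsum_le hf0' hwM (by positivity) fun i => ?_
      rw [norm_mul]
      exact mul_le_mul_of_nonneg_left (hfM i) (norm_nonneg _)
    have h2 : ‖∑' i, f i - T‖ ≤ M / ρ * ‖w - z‖ := by
      rw [hT, ← (NonarchimedeanAddGroup.summable_of_tendsto_cofinite_zero hf0).tsum_sub
        (NonarchimedeanAddGroup.summable_of_tendsto_cofinite_zero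
          (tendsto_div_cofinite_zero hxy (mul_pos hρ hρ) hden'))]
      refine IsUltrametricDist.norm_tsum_le_of_forall_le_of_nonneg (by positivity) fun i => ?_
      have h1 := hzx i
      have h2 := hzy i
      have h3 := hwy i
      rw [show f i - (x i - y i) / ((z - x i) * (z - y i)) = f i * (z - w) / (z - y i) by
        simp only [hf]; field_simp; ring, norm_div, norm_mul, norm_sub_rev z w,
        div_mul_eq_mul_div]
      refine div_le_div₀ (by positivity) ?_ hρ (hy i)
      exact mul_le_mul_of_nonneg_right (hfM i) (norm_nonneg _)
    rw [hprod, show u * ∏' i, (1 + (w - z) * f i) - u - (w - z) * (u * T) =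
      u * ((∏' i, (1 + (w - z) * f i) - 1 - (w - z) * ∑' i, f i) +
        (w - z) * (∑' i, f i - T)) by ring, norm_mul, mul_assoc]
    refine mul_le_mul_of_nonneg_left ((norm_add_le _ _).trans ?_) (norm_nonneg _)
    rw [norm_mul]
    have h3 := mul_le_mul_of_nonneg_left h2 (norm_nonneg (w - z))
    linarith
  rw [hasDerivAt_iff_isLittleO]
  refine Asymptotics.IsBigO.trans_isLittleO (g := fun w => ‖w - z‖ ^ 2) ?_
    (Asymptotics.isLittleO_pow_sub_sub z one_lt_two)
  refine Asymptotics.IsBigO.of_bound (‖u‖ * (M ^ 2 + M / ρ)) ?_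
  filter_upwards [Metric.ball_mem_nhds z (show 0 < min ρ (1 / (M + 1)) by positivity)] with w hw
  simpa using key w hw

end ThetaAnalysis

/-- Roots of an element of norm greater than `1` have norms above `1` but arbitrarily close to it,
so the value group is dense. -/
theorem exists_le_norm_lt {K : Type*} [NontriviallyNormedField K] [IsAlgClosed K] {r R : ℝ}
    (hr : 0 < r) (hrR : r < R) : ∃ e : K, r ≤ ‖e‖ ∧ ‖e‖ < R := by
  obtain ⟨b, hb⟩ := NormedField.exists_one_lt_norm K
  have h1 : 1 < R / r := (one_lt_div hr).2 hrR
  obtain ⟨n, hn⟩ := pow_unbounded_of_one_lt ‖b‖ h1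
  have hn0 : n ≠ 0 := by
    rintro rfl
    simp only [pow_zero] at hn
    linarith
  obtain ⟨e, he⟩ := IsAlgClosed.exists_pow_nat_eq b (Nat.pos_of_ne_zero hn0)
  have he1 : 1 < ‖e‖ := by
    rw [← he, norm_pow] at hb
    by_contra! h
    exact absurd (pow_le_one₀ (norm_nonneg e) h (n := n)) (not_le.2 hb)
  have he2 : ‖e‖ < R / r := by
    rw [← he, norm_pow] at hn
    exact lt_of_pow_lt_pow_left₀ n (by positivity) hn
  obtain ⟨k, hk1, hk2⟩ := exists_mem_Ioc_zpow hr he1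
  refine ⟨e ^ (k + 1), by rwa [norm_zpow], ?_⟩
  rw [norm_zpow, zpow_add_one₀ (by positivity)]
  calc ‖e‖ ^ k * ‖e‖ < r * (R / r) := mul_lt_mul'' hk1 he2 (by positivity) (by positivity)
    _ = R := by field_simp

/-! ### Normal form of a fractional linear map that moves `∞`. -/

section Moebius

variable {K : Type*} [NontriviallyNormedField K] [DecidableEq K]

theorem exists_smul_coe_eq_add_div (h : PGL(2, K)) (hinf : h • (∞ : OnePoint K) ≠ ∞) :
    ∃ A P κ : K, h • (∞ : OnePoint K) = A ∧ h • (P : OnePoint K) = ∞ ∧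
      ∀ x : K, x ≠ P → h • (x : OnePoint K) = ((A + κ / (x - P) : K) : OnePoint K) := by
  obtain ⟨M, rfl⟩ : ∃ M : GL (Fin 2) K, Matrix.ProjGenLinGroup.mk M = h :=
    QuotientGroup.mk_surjective h
  have hM : ∀ t : OnePoint K, (Matrix.ProjGenLinGroup.mk M : PGL(2, K)) • t = M • t := fun _ => rfl
  simp only [hM, OnePoint.smul_infty_eq_ite, OnePoint.smul_some_eq_ite] at hinf ⊢
  have h10 : M 1 0 ≠ 0 := fun h => hinf (by simp [h])
  refine ⟨M 0 0 / M 1 0, -(M 1 1 / M 1 0),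
    (M 0 1 - M 0 0 * (M 1 1 / M 1 0)) / M 1 0, by simp [h10], ?_, fun x hx => ?_⟩
  · rw [if_pos]
    field_simp
    ring
  · have hx' : M 1 0 * x + M 1 1 ≠ 0 := fun h => hx (by
      field_simp
      linear_combination h)
    have hx2 : x - -(M 1 1 / M 1 0) ≠ 0 := sub_ne_zero.2 hx
    rw [if_neg hx']
    congr 1
    have hx3 : x * M 1 0 + M 1 1 ≠ 0 := by rwa [mul_comm x]
    rw [sub_neg_eq_add] at hx2 ⊢
    have : x + M 1 1 / M 1 0 = (M 1 0 * x + M 1 1) / M 1 0 := by field_simp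
    rw [this]
    field_simp
    ring

end Moebius

/-! ### Ping-pong and contraction along reduced words. -/

section PingPong

variable {K : Type*} [NontriviallyNormedField K] [DecidableEq K] {X : Type*}

/-- Ping-pong data: a family of elements of `PGL(2, K)`, indexed by a set of letters with a formal
inverse, each moving the complement of the ball of the inverse letter into its own ball. -/
structure PingPong (h : X → PGL(2, K)) (inv : X → X) (ctr : X → K) (rad : X → ℝ) : Prop where
  rad_pos : ∀ s, 0 < rad s
  lt_dist : ∀ s t, s ≠ t → max (rad s) (rad t) < ‖ctr s - ctr t‖
  smul_mem_closedBall : ∀ s, ∀ t : OnePoint K,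
    t ∉ (fun x : K => (x : OnePoint K)) '' Metric.ball (ctr (inv s)) (rad (inv s)) →
    h s • t ∈ (fun x : K => (x : OnePoint K)) '' Metric.closedBall (ctr s) (rad s)
  smul_mem_ball : ∀ s, ∀ t : OnePoint K,
    t ∉ (fun x : K => (x : OnePoint K)) '' Metric.closedBall (ctr (inv s)) (rad (inv s)) →
    h s • t ∈ (fun x : K => (x : OnePoint K)) '' Metric.ball (ctr s) (rad s)

variable [IsUltrametricDist K]

variable {h : X → PGL(2, K)} {inv : X → X} {ctr : X → K} {rad : X → ℝ}

/-- With `h s = A + κ / (x - P)`, the difference of two values is `κ (y - x) / ((x - P) (y - P))`.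
The pole `P` lies in the ball of `inv s`, so both denominators have the norm of the difference of
the two centres, and `‖κ‖ ≤ rad s * rad (inv s)`. -/
theorem PingPong.norm_sub_le [IsAlgClosed K] (H : PingPong h inv ctr rad) {s t : X}
    (hst : inv s ≠ t) {x y x' y' : K} (hx : x ∈ Metric.closedBall (ctr t) (rad t))
    (hy : y ∈ Metric.closedBall (ctr t) (rad t)) (hx' : h s • (x : OnePoint K) = x')
    (hy' : h s • (y : OnePoint K) = y') :
    ‖x' - y'‖ ≤ rad s * rad (inv s) / ‖ctr (inv s) - ctr t‖ ^ 2 * ‖x - y‖ := by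
  have hr := H.rad_pos s
  have hr' := H.rad_pos (inv s)
  have hlt := max_lt_iff.1 (H.lt_dist _ _ hst)
  obtain ⟨A', hA', hA'eq⟩ := H.smul_mem_closedBall s ∞ (by simp)
  obtain ⟨A, P, κ, hA, hP, hκ⟩ := exists_smul_coe_eq_add_div (h s) (by rw [← hA'eq]; simp)
  obtain rfl : A' = A := OnePoint.coe_injective (hA'eq.trans hA)
  have hPmem : P ∈ Metric.ball (ctr (inv s)) (rad (inv s)) := by
    by_contra hcon
    obtain ⟨u, -, hu⟩ := H.smul_mem_closedBall s P (by simpa using hcon)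
    rw [hP] at hu
    exact OnePoint.coe_ne_infty _ hu
  -- Compare the images of `∞` and of `P + e`, with `‖e‖` at least `rad (inv s)` but arbitrarily
  -- close to it. Both points avoid the open ball of `inv s`, so their images, which differ by `κ /
  -- e`, are at most `rad s` apart.
  have hκle : ‖κ‖ ≤ rad s * rad (inv s) := by
    rw [← div_le_iff₀' hr]
    refine le_of_forall_gt_imp_ge_of_dense fun R hR => ?_
    obtain ⟨e, he1, he2⟩ := exists_le_norm_lt (K := K) hr' hR
    have he0 : 0 < ‖e‖ := hr'.trans_le he1
    have hePne : P + e ≠ P := by simpa using norm_pos_iff.1 he0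
    obtain ⟨u, hu, hueq⟩ := H.smul_mem_closedBall s ((P + e : K) : OnePoint K) (by
      rintro ⟨v, hv, hveq⟩
      obtain rfl : v = P + e := OnePoint.coe_injective hveq
      have := norm_sub_eq_of_mem_ball (z := P) (w := ctr (inv s)) (u := P + e) (ρ := ‖e‖)
        (Metric.ball_subset_ball he1 (by simpa [dist_comm] using hPmem)) (by simp)
      rw [mem_ball_iff_norm', this] at hv
      simp only [sub_add_cancel_left, norm_neg] at hv
      linarith)
    rw [hκ _ hePne] at hueq
    have hueq' := OnePoint.coe_injective hueq
    have h1 := norm_sub_le_of_mem_closedBall hu hA'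
    rw [hueq', add_sub_cancel_left, add_sub_cancel_left, norm_div, div_le_iff₀ he0] at h1
    rw [div_le_iff₀' hr]
    exact h1.trans (mul_le_mul_of_nonneg_left he2.le hr.le)
  have hnorm : ∀ v ∈ Metric.closedBall (ctr t) (rad t), ‖v - P‖ = ‖ctr (inv s) - ctr t‖ := by
    intro v hv
    rw [mem_closedBall_iff_norm] at hv
    rw [norm_sub_rev v P]
    have h2 : ‖ctr (inv s) - ctr t - (v - ctr t)‖ = ‖ctr (inv s) - ctr t‖ := by
      have := norm_sub_eq_of_mem_ball (z := ctr t) (w := v) (u := ctr (inv s))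
        (ρ := ‖ctr (inv s) - ctr t‖) (by
          rw [mem_ball_iff_norm]; exact hv.trans_lt hlt.2) (by rw [norm_sub_rev])
      rw [sub_sub_sub_cancel_right, norm_sub_rev, this, norm_sub_rev]
    rw [sub_sub_sub_cancel_right] at h2
    rw [← h2]
    refine norm_sub_eq_of_mem_ball (ρ := ‖ctr (inv s) - ctr t‖) ?_ h2.ge
    exact Metric.ball_subset_ball hlt.1.le hPmem
  have hR : 0 < ‖ctr (inv s) - ctr t‖ := hr'.trans hlt.1
  have hxP : x - P ≠ 0 := norm_pos_iff.1 (by rw [hnorm x hx]; exact hR)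
  have hyP : y - P ≠ 0 := norm_pos_iff.1 (by rw [hnorm y hy]; exact hR)
  rw [hκ _ (sub_ne_zero.1 hxP)] at hx'
  rw [hκ _ (sub_ne_zero.1 hyP)] at hy'
  rw [← OnePoint.coe_injective hx', ← OnePoint.coe_injective hy']
  rw [show A' + κ / (x - P) - (A' + κ / (y - P)) = κ * (y - x) / ((x - P) * (y - P)) by
    field_simp; ring, norm_div, norm_mul, norm_mul, hnorm x hx, hnorm y hy, norm_sub_rev y x, ← sq,
    div_mul_eq_mul_div]
  gcongr

/-- The last letter only places both images in one closed ball; each of the other `l.length` letters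
contributes a factor `q`. Those letters act on points outside the closed ball of their inverse,
which is why the images lie in an open ball once `l ≠ []`. -/
theorem PingPong.exists_smul_eq [IsAlgClosed K] (H : PingPong h inv ctr rad) {q : ℝ}
    (hq : ∀ s t, s ≠ t → rad s * rad t / ‖ctr s - ctr t‖ ^ 2 ≤ q) {x y : OnePoint K}
    (hx : ∀ s, x ∉ (fun x : K => (x : OnePoint K)) '' Metric.ball (ctr s) (rad s))
    (hy : ∀ s, y ∉ (fun x : K => (x : OnePoint K)) '' Metric.ball (ctr s) (rad s))
    (l : List X) (s : X) (hl : (s :: l).IsChain fun a b => inv a ≠ b) :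
    ∃ x' y' : K, ((s :: l).map h).prod • x = x' ∧ ((s :: l).map h).prod • y = y' ∧
      x' ∈ Metric.closedBall (ctr s) (rad s) ∧ y' ∈ Metric.closedBall (ctr s) (rad s) ∧
      (l ≠ [] → x' ∈ Metric.ball (ctr s) (rad s) ∧ y' ∈ Metric.ball (ctr s) (rad s)) ∧
      ‖x' - y'‖ ≤ rad s * q ^ l.length := by
  induction l generalizing s with
  | nil =>
    obtain ⟨x', hx', hxeq⟩ := H.smul_mem_closedBall s x (hx _)
    obtain ⟨y', hy', hyeq⟩ := H.smul_mem_closedBall s y (hy _)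
    refine ⟨x', y', by simpa using hxeq.symm, by simpa using hyeq.symm, hx', hy',
      fun h => absurd rfl h, ?_⟩
    simpa using norm_sub_le_of_mem_closedBall hx' hy'
  | cons t l ih =>
    rw [List.isChain_cons_cons] at hl
    obtain ⟨x₁, y₁, hx₁, hy₁, hxm, hym, -, hle⟩ := ih t hl.2
    have hout : ∀ v ∈ Metric.closedBall (ctr t) (rad t), (v : OnePoint K) ∉
        (fun x : K => (x : OnePoint K)) '' Metric.closedBall (ctr (inv s)) (rad (inv s)) := by
      rintro v hv ⟨v', hv', hvv⟩
      obtain rfl : v' = v := OnePoint.coe_injective hvv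
      have h1 := H.lt_dist _ _ hl.1
      have h2 : ‖ctr (inv s) - ctr t‖ ≤ max (rad (inv s)) (rad t) := by
        rw [← sub_add_sub_cancel (ctr (inv s)) v' (ctr t)]
        rw [mem_closedBall_iff_norm'] at hv'
        rw [mem_closedBall_iff_norm] at hv
        exact (IsUltrametricDist.norm_add_le_max _ _).trans (max_le_max hv' hv)
      linarith
    obtain ⟨x', hx', hxeq⟩ := H.smul_mem_ball s x₁ (hout _ hxm)
    obtain ⟨y', hy', hyeq⟩ := H.smul_mem_ball s y₁ (hout _ hym)
    refine ⟨x', y', ?_, ?_, Metric.ball_subset_closedBall hx', Metric.ball_subset_closedBall hy',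
      fun _ => ⟨hx', hy'⟩, ?_⟩
    · rw [List.map_cons, List.prod_cons, mul_smul, hx₁, ← hxeq]
    · rw [List.map_cons, List.prod_cons, mul_smul, hy₁, ← hyeq]
    · have hs := H.rad_pos s
      have hi := H.rad_pos (inv s)
      have ht := H.rad_pos t
      have hq0 : 0 ≤ q := le_trans (by positivity) (hq _ _ hl.1)
      refine (H.norm_sub_le hl.1 hxm hym hxeq.symm hyeq.symm).trans ?_
      calc _ ≤ rad s * rad (inv s) / ‖ctr (inv s) - ctr t‖ ^ 2 * (rad t * q ^ l.length) := by
            gcongr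
        -- The radius of `t` from the induction hypothesis pairs with that of `inv s`, so the bound
        -- `hq` applies and only `rad s` is left over.
        _ = rad s * (rad (inv s) * rad t / ‖ctr (inv s) - ctr t‖ ^ 2) * q ^ l.length := by ring
        _ ≤ rad s * q * q ^ l.length := by
            gcongr
            exact hq _ _ hl.1
        _ = rad s * q ^ (t :: l).length := by rw [List.length_cons]; ring

end PingPong

/-! ### Balls not containing `∞`: radii, diameters and distances. -/

section ProjBall

theorem ProjBall.radius_pos {K : Type*} (D : ProjBall K) : 0 < D.radius := by
  cases D <;> assumption

variable {K : Type*} [NontriviallyNormedField K]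

theorem ProjBall.closedBall_eq (D : ProjBall K) (hD : (∞ : OnePoint K) ∉ D.closedBall) :
    D.closedBall = (fun x : K => (x : OnePoint K)) '' Metric.closedBall D.center D.radius := by
  cases D with
  | disc a r hr => rfl
  | codisc a r hr => exact absurd (by simp [ProjBall.closedBall]) hD

theorem ProjBall.openBall_eq (D : ProjBall K) (hD : (∞ : OnePoint K) ∉ D.closedBall) :
    D.openBall = (fun x : K => (x : OnePoint K)) '' Metric.ball D.center D.radius := by
  cases D with
  | disc a r hr => rfl
  | codisc a r hr => exact absurd (by simp [ProjBall.closedBall]) hD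

theorem ProjBall.openBall_subset_closedBall (D : ProjBall K) : D.openBall ⊆ D.closedBall := by
  cases D with
  | disc a r hr => exact Set.image_mono Metric.ball_subset_closedBall
  | codisc a r hr => exact Set.compl_subset_compl.2 (Set.image_mono Metric.ball_subset_closedBall)

theorem ProjBall.setOf_coe_mem_openBall (D : ProjBall K) (hD : (∞ : OnePoint K) ∉ D.closedBall) :
    {x : K | (x : OnePoint K) ∈ D.openBall} = Metric.ball D.center D.radius := by
  rw [D.openBall_eq hD]
  exact Set.preimage_image_eq _ OnePoint.coe_injective

theorem ProjBall.diam_pos (D : ProjBall K) (hD : (∞ : OnePoint K) ∉ D.closedBall) :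
    0 < D.diam := by
  rw [ProjBall.diam, D.setOf_coe_mem_openBall hD]
  obtain ⟨e, he0, he⟩ := NormedField.exists_norm_lt K D.radius_pos
  refine he0.trans_le ?_
  have := Metric.dist_le_diam_of_mem Metric.isBounded_ball
    (Metric.mem_ball_self (x := D.center) D.radius_pos)
    (show D.center + e ∈ Metric.ball D.center D.radius by simpa [mem_ball_iff_norm] using he)
  simpa using this

theorem ProjBall.max_radius_lt (D E : ProjBall K) (hD : (∞ : OnePoint K) ∉ D.closedBall)
    (hE : (∞ : OnePoint K) ∉ E.closedBall) (h : Disjoint D.closedBall E.closedBall) :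
    max D.radius E.radius < ‖D.center - E.center‖ := by
  rw [D.closedBall_eq hD, E.closedBall_eq hE,
    Set.disjoint_image_iff OnePoint.coe_injective, Set.disjoint_left] at h
  refine max_lt ?_ ?_
  · by_contra! hle
    exact h (mem_closedBall_iff_norm'.2 hle) (Metric.mem_closedBall_self E.radius_pos.le)
  · by_contra! hle
    exact h (Metric.mem_closedBall_self D.radius_pos.le) (mem_closedBall_iff_norm.2 hle)

/-- For disjoint balls the maximum defining `R` is attained by the distance of the centres. -/
theorem ProjBall.treeDist_eq (D E : ProjBall K) {p : ℝ}
    (h : max D.radius E.radius < ‖D.center - E.center‖) :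
    D.treeDist p E = Real.logb p (‖D.center - E.center‖ ^ 2 / (D.radius * E.radius)) := by
  have hD := D.radius_pos
  have hE := E.radius_pos
  have hR : 0 < ‖D.center - E.center‖ := hD.trans ((le_max_left _ _).trans_lt h)
  rw [ProjBall.treeDist, max_eq_right h.le, ← Real.logb_mul (by positivity) (by positivity)]
  congr 1
  ring

variable [IsUltrametricDist K]

theorem ProjBall.diam_le (D : ProjBall K) (hD : (∞ : OnePoint K) ∉ D.closedBall) :
    D.diam ≤ D.radius := by
  rw [ProjBall.diam, D.setOf_coe_mem_openBall hD]
  refine Metric.diam_le_of_forall_dist_le D.radius_pos.le fun x hx y hy => ?_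
  rw [dist_eq_norm]
  exact norm_sub_le_of_mem_closedBall (Metric.ball_subset_closedBall hx)
    (Metric.ball_subset_closedBall hy)

end ProjBall

/-! ### Reduced words in the generators. -/

section Words

variable {K : Type*} [NontriviallyNormedField K] {g : ℕ} (γ : Fin g → PGL(2, K))

theorem letter_mem_grp (x : Fin g × Bool) : letter γ x ∈ grp γ := by
  have h : γ x.1 ∈ grp γ := Subgroup.subset_closure (Set.mem_range_self _)
  rw [letter]
  split_ifs
  exacts [h, inv_mem h]

theorem wordSet_subset_grp (m : ℕ) : wordSet γ m ⊆ grp γ := by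
  rintro _ ⟨w, -, -, rfl⟩
  refine Subgroup.list_prod_mem _ fun δ hδ => ?_
  obtain ⟨x, -, rfl⟩ := List.mem_map.1 hδ
  exact letter_mem_grp γ x

/-- `Γ` is the image of the free group, whose elements have reduced words. Freeness of `Γ` itself
plays no role. -/
theorem exists_isReduced_prod_eq {δ : PGL(2, K)} (hδ : δ ∈ grp γ) :
    ∃ w : List (Fin g × Bool), FreeGroup.IsReduced w ∧ (w.map (letter γ)).prod = δ := by
  rw [grp, ← FreeGroup.range_lift_eq_closure] at hδ
  obtain ⟨w, rfl⟩ := hδ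
  refine ⟨w.toWord, FreeGroup.isReduced_toWord, ?_⟩
  conv_rhs => rw [← FreeGroup.mk_toWord (x := w), FreeGroup.lift_mk]
  congr 1
  refine List.map_congr_left fun x _ => ?_
  rcases x with ⟨i, _ | _⟩ <;> rfl

/-- The formal inverse of a letter. -/
def letterInv (x : Fin g × Bool) : Fin g × Bool := (x.1, !x.2)

/-- The index of the ball into which a letter moves the complement of the ball of its inverse. -/
def letterIdx (x : Fin g × Bool) : Fin g ⊕ Fin g := if x.2 then .inl x.1 else .inr x.1

theorem letterIdx_injective : Function.Injective (letterIdx (g := g)) := by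
  rintro ⟨i, _ | _⟩ ⟨j, _ | _⟩ h <;> simp_all [letterIdx]

theorem isChain_letterInv_ne {w : List (Fin g × Bool)} (hw : FreeGroup.IsReduced w) :
    w.IsChain fun a b => letterInv a ≠ b := by
  refine List.IsChain.imp (fun a b hab hne => ?_) hw
  subst hne
  have := hab rfl
  simp [letterInv] at this

end Words

/-! ### Ping-pong for a good fundamental domain. -/

section GoodFundamentalDomain

variable {K : Type*} [NontriviallyNormedField K] {g : ℕ} {γ : Fin g → PGL(2, K)}
  {B B' : Fin g → ProjBall K}

theorem coe_coord {x : OnePoint K} (hx : x ≠ ∞) : ((coord x : K) : OnePoint K) = x := by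
  induction x using OnePoint.rec with
  | infty => exact absurd rfl hx
  | coe x => rfl

theorem infty_notMem_closedBall (hinfty : (∞ : OnePoint K) ∈ domainInterior B B')
    (j : Fin g ⊕ Fin g) : (∞ : OnePoint K) ∉ (allBalls B B' j).closedBall :=
  fun h => hinfty (Set.mem_iUnion.2 ⟨j, h⟩)

theorem notMem_ball_of_mem_domain (hinfty : (∞ : OnePoint K) ∈ domainInterior B B')
    {t : OnePoint K} (ht : t ∈ domain B B') (j : Fin g ⊕ Fin g) :
    t ∉ (fun x : K => (x : OnePoint K)) ''
      Metric.ball (allBalls B B' j).center (allBalls B B' j).radius := by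
  rw [← ProjBall.openBall_eq _ (infty_notMem_closedBall hinfty _)]
  exact fun h => ht (Set.mem_iUnion.2 ⟨j, h⟩)

variable [DecidableEq K]

theorem IsGoodFundamentalDomain.letter_smul_mem_closedBall (hF : IsGoodFundamentalDomain γ B B')
    (s : Fin g × Bool) {t : OnePoint K} (ht : t ∉ (allBalls B B' (letterIdx (letterInv s))).openBall) :
    letter γ s • t ∈ (allBalls B B' (letterIdx s)).closedBall := by
  rcases s with ⟨i, _ | _⟩
  · change (γ i)⁻¹ • t ∈ (B' i).closedBall
    rw [← hF.image_inv i]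
    exact ⟨t, ht, rfl⟩
  · change γ i • t ∈ (B i).closedBall
    rw [← hF.image i]
    exact ⟨t, ht, rfl⟩

theorem IsGoodFundamentalDomain.letter_smul_mem_openBall (hF : IsGoodFundamentalDomain γ B B')
    (s : Fin g × Bool) {t : OnePoint K}
    (ht : t ∉ (allBalls B B' (letterIdx (letterInv s))).closedBall) :
    letter γ s • t ∈ (allBalls B B' (letterIdx s)).openBall := by
  -- A point outside the open ball of `s` is sent by the inverse letter into the closed ball of that
  -- inverse.
  by_contra hcon
  refine ht ?_
  rcases s with ⟨i, _ | _⟩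
  · change t ∈ (B i).closedBall
    rw [← hF.image i]
    exact ⟨_, hcon, smul_inv_smul _ _⟩
  · change t ∈ (B' i).closedBall
    rw [← hF.image_inv i]
    exact ⟨_, hcon, inv_smul_smul _ _⟩

theorem IsGoodFundamentalDomain.mem_domain_of_mem_diff (hF : IsGoodFundamentalDomain γ B B')
    {j : Fin g ⊕ Fin g} {t : OnePoint K}
    (ht : t ∈ (allBalls B B' j).closedBall \ (allBalls B B' j).openBall) : t ∈ domain B B' := by
  intro h
  obtain ⟨k, hk⟩ := Set.mem_iUnion.1 h
  obtain rfl | hjk := eq_or_ne j k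
  · exact ht.2 hk
  · exact Set.disjoint_left.1 (hF.disjoint hjk) ht.1 (ProjBall.openBall_subset_closedBall _ hk)

/-- Boundary goes to boundary; hence `γᵢ a`, like `a`, lies in the domain `F`. -/
theorem IsGoodFundamentalDomain.smul_mem_diff (hF : IsGoodFundamentalDomain γ B B') {i : Fin g}
    {t : OnePoint K} (ht : t ∈ (B' i).closedBall \ (B' i).openBall) :
    γ i • t ∈ (B i).closedBall \ (B i).openBall := by
  refine ⟨hF.letter_smul_mem_closedBall (i, true) ht.2, fun h => ?_⟩
  have h1 := ht.1
  rw [← hF.image_inv i] at h1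
  obtain ⟨u, hu, rfl⟩ := h1
  exact hu (by simpa using h)

theorem IsGoodFundamentalDomain.pingPong (hF : IsGoodFundamentalDomain γ B B')
    (hinfty : (∞ : OnePoint K) ∈ domainInterior B B') :
    PingPong (letter γ) letterInv (fun s => (allBalls B B' (letterIdx s)).center)
      (fun s => (allBalls B B' (letterIdx s)).radius) where
  rad_pos _ := ProjBall.radius_pos _
  lt_dist _ _ hst := ProjBall.max_radius_lt _ _ (infty_notMem_closedBall hinfty _)
    (infty_notMem_closedBall hinfty _) (hF.disjoint (letterIdx_injective.ne hst))
  smul_mem_closedBall s t ht := by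
    rw [← ProjBall.openBall_eq _ (infty_notMem_closedBall hinfty _)] at ht
    rw [← ProjBall.closedBall_eq _ (infty_notMem_closedBall hinfty _)]
    exact hF.letter_smul_mem_closedBall s ht
  smul_mem_ball s t ht := by
    rw [← ProjBall.closedBall_eq _ (infty_notMem_closedBall hinfty _)] at ht
    rw [← ProjBall.openBall_eq _ (infty_notMem_closedBall hinfty _)]
    exact hF.letter_smul_mem_openBall s ht

variable [IsUltrametricDist K] [IsAlgClosed K]

/-- The ping-pong estimate for an element of the group that is not a short word. -/
theorem IsGoodFundamentalDomain.exists_smul_eq (hF : IsGoodFundamentalDomain γ B B')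
    (hinfty : (∞ : OnePoint K) ∈ domainInterior B B') {q : ℝ} (hq0 : 0 ≤ q) (hq1 : q ≤ 1)
    (hq : ∀ j k, j ≠ k → (allBalls B B' j).radius * (allBalls B B' k).radius /
      ‖(allBalls B B' j).center - (allBalls B B' k).center‖ ^ 2 ≤ q)
    {x y : OnePoint K} (hx : x ∈ domain B B') (hy : y ∈ domain B B') {n : ℕ} {δ : PGL(2, K)}
    (hδ : δ ∈ grp γ) (hδn : δ ∉ wordSet γ n) :
    ∃ (j : Fin g ⊕ Fin g) (x' y' : K), δ • x = x' ∧ δ • y = y' ∧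
      (1 ≤ n → x' ∈ Metric.ball (allBalls B B' j).center (allBalls B B' j).radius ∧
        y' ∈ Metric.ball (allBalls B B' j).center (allBalls B B' j).radius) ∧
      ‖x' - y'‖ ≤ (allBalls B B' j).radius * q ^ n := by
  obtain ⟨w, hw, rfl⟩ := exists_isReduced_prod_eq γ hδ
  -- The word has at least `n + 1` letters; its first letter fixes the ball and the others give `q ^
  -- n`.
  have hlen : n < w.length := by
    by_contra! h
    exact hδn ⟨w, hw, h, rfl⟩
  cases w with
  | nil => simp at hlen
  | cons s l =>
    rw [List.length_cons] at hlen
    obtain ⟨x', y', hx', hy', -, -, hball, hle⟩ := (hF.pingPong hinfty).exists_smul_eq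
      (fun s t hst => hq _ _ (letterIdx_injective.ne hst))
      (fun s => notMem_ball_of_mem_domain hinfty hx _)
      (fun s => notMem_ball_of_mem_domain hinfty hy _) l s (isChain_letterInv_ne hw)
    refine ⟨letterIdx s, x', y', hx', hy', fun hn => hball ?_, hle.trans ?_⟩
    · rintro rfl
      simp only [List.length_nil] at hlen
      omega
    · exact mul_le_mul_of_nonneg_left (pow_le_pow_of_le_one hq0 hq1 (by omega))
        (ProjBall.radius_pos _).le

theorem IsGoodFundamentalDomain.smul_ne_infty (hF : IsGoodFundamentalDomain γ B B')
    (hinfty : (∞ : OnePoint K) ∈ domainInterior B B') {x : K}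
    (hx : (x : OnePoint K) ∈ domain B B') {δ : PGL(2, K)} (hδ : δ ∈ grp γ) :
    δ • (x : OnePoint K) ≠ ∞ := by
  by_cases hδ0 : δ ∈ wordSet γ 0
  · obtain ⟨w, -, hw, rfl⟩ := hδ0
    obtain rfl := List.length_eq_zero_iff.1 (Nat.le_zero.1 hw)
    simp
  -- Only finiteness of the image is wanted, so the trivial ratio `q = 1` suffices.
  · obtain ⟨-, x', -, hx', -⟩ := hF.exists_smul_eq hinfty zero_le_one le_rfl (fun j k hjk => by
      have h := ProjBall.max_radius_lt _ _ (infty_notMem_closedBall hinfty j)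
        (infty_notMem_closedBall hinfty k) (hF.disjoint hjk)
      have hj := (allBalls B B' j).radius_pos
      have hk := (allBalls B B' k).radius_pos
      have h' := max_lt_iff.1 h
      refine div_le_one_of_le₀ ?_ (sq_nonneg _)
      rw [sq]
      exact mul_le_mul h'.1.le h'.2.le hk.le (norm_nonneg _)) hx hx hδ hδ0
    rw [hx']
    exact OnePoint.coe_ne_infty _

end GoodFundamentalDomain

/-! ### Estimates for the orbit and for the terms of the logarithmic derivative. -/

section Theta

open Filter

variable {K : Type*} [NontriviallyNormedField K] {g : ℕ} {B B' : Fin g → ProjBall K}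

theorem radius_mul_div_le_rpow {p c : ℝ} (hp : 1 < p) {D E : ProjBall K}
    (h : max D.radius E.radius < ‖D.center - E.center‖) (hc : c ≤ D.treeDist p E) :
    D.radius * E.radius / ‖D.center - E.center‖ ^ 2 ≤ p ^ (-c) := by
  have hD := D.radius_pos
  have hE := E.radius_pos
  have hR : 0 < ‖D.center - E.center‖ := hD.trans ((le_max_left _ _).trans_lt h)
  rw [ProjBall.treeDist_eq D E h, Real.le_logb_iff_rpow_le hp (by positivity)] at hc
  rw [Real.rpow_neg (by linarith), ← inv_div]
  exact inv_anti₀ (by positivity) hc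

theorem treeDist_pos {p : ℝ} (hp : 1 < p) {D E : ProjBall K}
    (h : max D.radius E.radius < ‖D.center - E.center‖) : 0 < D.treeDist p E := by
  have hD := D.radius_pos
  have hE := E.radius_pos
  have h' := max_lt_iff.1 h
  rw [ProjBall.treeDist_eq D E h]
  refine Real.logb_pos hp ((one_lt_div (by positivity)).2 ?_)
  rw [sq]
  exact mul_lt_mul'' h'.1 h'.2 hD.le hE.le

theorem finite_setOf_mem_wordSet (γ : Fin g → PGL(2, K)) (n : ℕ) :
    {δ : grp γ | (δ : PGL(2, K)) ∈ wordSet γ n}.Finite :=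
  (wordSet_finite γ n).preimage Subtype.val_injective.injOn

variable [IsUltrametricDist K]

theorem radius_le_norm_sub (hinfty : (∞ : OnePoint K) ∈ domainInterior B B') {z x : K}
    (hz : (z : OnePoint K) ∈ domain B B') {j : Fin g ⊕ Fin g}
    (hx : x ∈ Metric.ball (allBalls B B' j).center (allBalls B B' j).radius) :
    (allBalls B B' j).radius ≤ ‖z - x‖ := by
  by_contra! h
  refine notMem_ball_of_mem_domain hinfty hz j ⟨z, ?_, rfl⟩
  rw [mem_ball_iff_norm] at hx ⊢
  rw [← sub_add_sub_cancel z x]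
  exact (IsUltrametricDist.norm_add_le_max _ _).trans_lt (max_lt h hx)

variable [DecidableEq K] [IsAlgClosed K] {γ : Fin g → PGL(2, K)}

theorem IsGoodFundamentalDomain.tendsto_coord_sub_coord (hF : IsGoodFundamentalDomain γ B B')
    (hinfty : (∞ : OnePoint K) ∈ domainInterior B B') {q : ℝ} (hq0 : 0 ≤ q) (hq1 : q < 1)
    (hq : ∀ j k, j ≠ k → (allBalls B B' j).radius * (allBalls B B' k).radius /
      ‖(allBalls B B' j).center - (allBalls B B' k).center‖ ^ 2 ≤ q)
    {x y : OnePoint K} (hx : x ∈ domain B B') (hy : y ∈ domain B B') :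
    Tendsto (fun δ : grp γ => coord ((δ : PGL(2, K)) • x) - coord ((δ : PGL(2, K)) • y))
      cofinite (𝓝 0) := by
  obtain ⟨r, hr⟩ := (Set.finite_range fun j => (allBalls B B' j).radius).bddAbove
  replace hr : ∀ j, (allBalls B B' j).radius ≤ r := fun j => hr ⟨j, rfl⟩
  rw [Metric.tendsto_nhds]
  intro ε hε
  have hlim : Tendsto (fun n : ℕ => r * q ^ n) atTop (𝓝 0) := by
    simpa using (tendsto_pow_atTop_nhds_zero_of_lt_one hq0 hq1).const_mul r
  obtain ⟨n, hn⟩ := (hlim.eventually_lt_const hε).exists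
  rw [eventually_cofinite]
  -- The exceptional elements all lie in the finite set of words of length at most `n`.
  refine (finite_setOf_mem_wordSet γ n).subset fun δ hδ => ?_
  by_contra hδn
  obtain ⟨j, x', y', hx', hy', -, hle⟩ := hF.exists_smul_eq hinfty hq0 hq1.le hq hx hy δ.2 hδn
  refine hδ ?_
  rw [hx', hy', dist_zero_right]
  exact (hle.trans (mul_le_mul_of_nonneg_right (hr j) (by positivity))).trans_lt hn

/-- A point of the domain has positive distance from the orbits of points of the domain that do not
contain it. -/
theorem IsGoodFundamentalDomain.exists_le_norm_sub_coord (hF : IsGoodFundamentalDomain γ B B')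
    (hinfty : (∞ : OnePoint K) ∈ domainInterior B B') {q : ℝ} (hq0 : 0 ≤ q) (hq1 : q ≤ 1)
    (hq : ∀ j k, j ≠ k → (allBalls B B' j).radius * (allBalls B B' k).radius /
      ‖(allBalls B B' j).center - (allBalls B B' k).center‖ ^ 2 ≤ q)
    {x : OnePoint K} (hx : x ∈ domain B B') {z : K} (hz : (z : OnePoint K) ∈ domain B B')
    {d : ℝ} (hd0 : 0 < d) (hd : ∀ j, d ≤ (allBalls B B' j).radius)
    (hzx : ∀ δ ∈ grp γ, z ≠ coord (δ • x)) :
    ∃ ρ > 0, ∀ δ ∈ grp γ, ρ ≤ ‖z - coord (δ • x)‖ := by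
  -- Finitely many orbit points come from words of length at most `1`. All others lie in one of the
  -- open balls, hence at distance at least `d` from `z`.
  have h1 : ∀ᶠ ρ in 𝓝[>] (0 : ℝ), ∀ δ ∈ wordSet γ 1, ρ ≤ ‖z - coord (δ • x)‖ := by
    rw [eventually_all_finite (wordSet_finite γ 1)]
    intro δ hδ
    have hpos := norm_pos_iff.2 (sub_ne_zero.2 (hzx δ (wordSet_subset_grp γ 1 hδ)))
    filter_upwards [Ioo_mem_nhdsGT hpos] with ρ hρ using hρ.2.le
  obtain ⟨ρ, hρ1, hρ2⟩ := (h1.and (Ioo_mem_nhdsGT hd0)).exists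
  refine ⟨ρ, hρ2.1, fun δ hδ => ?_⟩
  by_cases hδ1 : δ ∈ wordSet γ 1
  · exact hρ1 δ hδ1
  · obtain ⟨j, x', y', hx', -, hball, -⟩ := hF.exists_smul_eq hinfty hq0 hq1 hq hx hx hδ hδ1
    rw [hx']
    exact (hρ2.2.le.trans (hd j)).trans (radius_le_norm_sub hinfty hz (hball le_rfl).1)

/-- The condition `1 ≤ m` puts the orbit points in an open ball, which `z` avoids; `z` may lie on
the boundary of the closed one. -/
theorem IsGoodFundamentalDomain.norm_logDeriv_term_le (hF : IsGoodFundamentalDomain γ B B')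
    (hinfty : (∞ : OnePoint K) ∈ domainInterior B B') {q : ℝ} (hq0 : 0 ≤ q) (hq1 : q ≤ 1)
    (hq : ∀ j k, j ≠ k → (allBalls B B' j).radius * (allBalls B B' k).radius /
      ‖(allBalls B B' j).center - (allBalls B B' k).center‖ ^ 2 ≤ q)
    {x y : OnePoint K} (hx : x ∈ domain B B') (hy : y ∈ domain B B') {z : K}
    (hz : (z : OnePoint K) ∈ domain B B') {d : ℝ} (hd0 : 0 < d)
    (hd : ∀ j, d ≤ (allBalls B B' j).radius) {m : ℕ} (hm : 1 ≤ m) {δ : PGL(2, K)}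
    (hδ : δ ∈ grp γ) (hδm : δ ∉ wordSet γ m) :
    ‖(coord (δ • x) - coord (δ • y)) / ((z - coord (δ • x)) * (z - coord (δ • y)))‖ ≤
      q ^ m / d := by
  obtain ⟨j, x', y', hx', hy', hball, hle⟩ := hF.exists_smul_eq hinfty hq0 hq1 hq hx hy hδ hδm
  have hr := (allBalls B B' j).radius_pos
  rw [hx', hy', norm_div, norm_mul]
  have h1 := radius_le_norm_sub hinfty hz (hball hm).1
  have h2 := radius_le_norm_sub hinfty hz (hball hm).2
  calc _ ≤ (allBalls B B' j).radius * q ^ m /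
        ((allBalls B B' j).radius * (allBalls B B' j).radius) := by
        exact div_le_div₀ (by positivity) hle (by positivity)
          (mul_le_mul h1 h2 hr.le (norm_nonneg _))
    _ = q ^ m / (allBalls B B' j).radius := by field_simp
    _ ≤ q ^ m / d := div_le_div_of_nonneg_left (by positivity) hd0 (hd j)

end Theta

end MumfordCurve

/-! ### The truncation estimate. -/

theorem proposition3p6 {K : Type*} [NontriviallyNormedField K] [IsUltrametricDist K]
    [CompleteSpace K] [IsAlgClosed K] [DecidableEq K]
    {g : ℕ} (γ : Fin g → PGL(2, K)) (B B' : Fin g → MumfordCurve.ProjBall K)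
    (hF : MumfordCurve.IsGoodFundamentalDomain γ B B')
    (hinfty : (∞ : OnePoint K) ∈ MumfordCurve.domainInterior B B')
    (p : ℝ) (hp : 1 < p)
    (c : ℝ) (hc : IsLeast {t : ℝ | ∃ j k : Fin g ⊕ Fin g, j ≠ k ∧
      t = (MumfordCurve.allBalls B B' j).treeDist p (MumfordCurve.allBalls B B' k)} c)
    (d : ℝ) (hd : IsLeast (Set.range fun j : Fin g ⊕ Fin g =>
      (MumfordCurve.allBalls B B' j).diam) d)
    (i : Fin g) (a : K)
    (ha : (a : OnePoint K) ∈ (B' i).closedBall \ (B' i).openBall)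
    (z : K) (hz : (z : OnePoint K) ∈ MumfordCurve.domain B B')
    (hza : ∀ δ ∈ MumfordCurve.grp γ, δ • (a : OnePoint K) ≠ (z : OnePoint K))
    (m : ℕ) (hm : 1 ≤ m) :
    -- all the points `δa` are finite, so every term below has its literal meaning
    (∀ δ ∈ MumfordCurve.grp γ, δ • (a : OnePoint K) ≠ ∞) ∧
    -- the infinite product defining `u_{γᵢ}` converges near `z`
    (∀ᶠ w in 𝓝 z, Multipliable fun δ : MumfordCurve.grp γ =>
      MumfordCurve.thetaFactor (a : OnePoint K) (γ i • (a : OnePoint K)) w δ) ∧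
    DifferentiableAt K (MumfordCurve.uFun γ (γ i) (a : OnePoint K)) z ∧
    MumfordCurve.uFun γ (γ i) (a : OnePoint K) z ≠ 0 ∧
    ‖MumfordCurve.truncatedSum γ m (γ i) (a : OnePoint K) z -
        deriv (MumfordCurve.uFun γ (γ i) (a : OnePoint K)) z /
          MumfordCurve.uFun γ (γ i) (a : OnePoint K) z‖ ≤
      p ^ (-(m : ℝ) * c - Real.logb p d) := by
  open MumfordCurve in
  have hp0 : 0 < p := by linarith
  have hinf := infty_notMem_closedBall hinfty
  have hlt : ∀ j k, j ≠ k → max (allBalls B B' j).radius (allBalls B B' k).radius <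
      ‖(allBalls B B' j).center - (allBalls B B' k).center‖ := fun j k hjk =>
    ProjBall.max_radius_lt _ _ (hinf j) (hinf k) (hF.disjoint hjk)
  have hc0 : 0 < c := by
    obtain ⟨j, k, hjk, rfl⟩ := hc.1
    exact treeDist_pos hp (hlt j k hjk)
  set q : ℝ := p ^ (-c) with hq_def
  have hq0 : 0 ≤ q := by positivity
  have hq1 : q < 1 := Real.rpow_lt_one_of_one_lt_of_neg hp (by linarith)
  have hq : ∀ j k, j ≠ k → (allBalls B B' j).radius * (allBalls B B' k).radius /
      ‖(allBalls B B' j).center - (allBalls B B' k).center‖ ^ 2 ≤ q := fun j k hjk =>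
    radius_mul_div_le_rpow hp (hlt j k hjk) (hc.2 ⟨j, k, hjk, rfl⟩)
  have hd0 : 0 < d := by
    obtain ⟨j, rfl⟩ := hd.1
    exact ProjBall.diam_pos _ (hinf j)
  have hdr : ∀ j, d ≤ (allBalls B B' j).radius := fun j =>
    (hd.2 ⟨j, rfl⟩).trans (ProjBall.diam_le _ (hinf j))
  have haF : (a : OnePoint K) ∈ domain B B' := hF.mem_domain_of_mem_diff (j := .inr i) ha
  have hbF : γ i • (a : OnePoint K) ∈ domain B B' :=
    hF.mem_domain_of_mem_diff (j := .inl i) (hF.smul_mem_diff ha)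
  have hγi : γ i ∈ grp γ := Subgroup.subset_closure (Set.mem_range_self i)
  have hfin : ∀ δ ∈ grp γ, δ • (a : OnePoint K) ≠ ∞ := fun δ hδ => hF.smul_ne_infty hinfty haF hδ
  have hzx : ∀ δ ∈ grp γ, z ≠ coord (δ • (a : OnePoint K)) := fun δ hδ h =>
    hza δ hδ (by rw [h, coe_coord (hfin δ hδ)])
  have hzy : ∀ δ ∈ grp γ, z ≠ coord (δ • γ i • (a : OnePoint K)) := fun δ hδ => by
    rw [← mul_smul]
    exact hzx _ (mul_mem hδ hγi)
  obtain ⟨ρ₁, hρ₁, hx⟩ := hF.exists_le_norm_sub_coord hinfty hq0 hq1.le hq haF hz hd0 hdr hzx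
  obtain ⟨ρ₂, hρ₂, hy⟩ := hF.exists_le_norm_sub_coord hinfty hq0 hq1.le hq hbF hz hd0 hdr hzy
  have hρ : 0 < min ρ₁ ρ₂ := lt_min hρ₁ hρ₂
  have hx' : ∀ δ : grp γ, min ρ₁ ρ₂ ≤ ‖z - coord ((δ : PGL(2, K)) • (a : OnePoint K))‖ :=
    fun δ => (min_le_left _ _).trans (hx δ δ.2)
  have hy' : ∀ δ : grp γ, min ρ₁ ρ₂ ≤ ‖z - coord ((δ : PGL(2, K)) • γ i • (a : OnePoint K))‖ :=
    fun δ => (min_le_right _ _).trans (hy δ δ.2)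
  have hxy := hF.tendsto_coord_sub_coord hinfty hq0 hq1 hq haF hbF
  have hderiv := hasDerivAt_tprod_div_of_tendsto hxy hρ hx' hy'
  have hne : uFun γ (γ i) (a : OnePoint K) z ≠ 0 := tprod_div_ne_zero_of_tendsto hxy hρ hx' hy'
  refine ⟨hfin, ?_, hderiv.differentiableAt, hne, ?_⟩
  · filter_upwards [Metric.ball_mem_nhds z hρ] with w hw
    exact multipliable_div_of_tendsto hxy hρ hy' hw
  set f : PGL(2, K) → K := fun δ =>
    (coord (δ • (a : OnePoint K)) - coord (δ • γ i • (a : OnePoint K))) /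
      ((z - coord (δ • (a : OnePoint K))) * (z - coord (δ • γ i • (a : OnePoint K)))) with hf
  -- The derivative is the product times the sum, so dividing by the nonzero product leaves the sum.
  have hlog : deriv (uFun γ (γ i) (a : OnePoint K)) z / uFun γ (γ i) (a : OnePoint K) z =
      ∑' δ : grp γ, f δ := by
    rw [div_eq_iff hne, mul_comm]
    exact hderiv.deriv
  have hsum : Summable fun δ : grp γ => f δ :=
    NonarchimedeanAddGroup.summable_of_tendsto_cofinite_zero
      (tendsto_div_cofinite_zero hxy (mul_pos hρ hρ) fun δ => by
        rw [norm_mul]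
        exact mul_le_mul (hx' δ) (hy' δ) hρ.le (norm_nonneg _))
  have htrunc : truncatedSum γ m (γ i) (a : OnePoint K) z =
      ∑ δ ∈ (finite_setOf_mem_wordSet γ m).toFinset, f δ := by
    refine (Finset.sum_nbij (fun δ : grp γ => (δ : PGL(2, K))) (fun δ hδ => by simpa using hδ)
      Subtype.val_injective.injOn (fun δ hδ => ?_) fun _ _ => rfl).symm
    have hδ' : δ ∈ wordSet γ m := by simpa using hδ
    exact ⟨⟨δ, wordSet_subset_grp γ m hδ'⟩, by simpa using hδ', rfl⟩
  have hbound : p ^ (-(m : ℝ) * c - Real.logb p d) = q ^ m / d := by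
    rw [Real.rpow_sub hp0, Real.rpow_logb hp0 hp.ne' hd0, hq_def, ← Real.rpow_mul_natCast hp0.le]
    congr 2
    ring
  -- Splitting the full sum at `Γₘ` leaves minus the tail, to which the ultrametric bound applies
  -- termwise.
  rw [hlog, htrunc, ← hsum.sum_add_tsum_compl (s := (finite_setOf_mem_wordSet γ m).toFinset),
    sub_add_cancel_left, norm_neg, hbound]
  refine IsUltrametricDist.norm_tsum_le_of_forall_le_of_nonneg (by positivity) fun δ => ?_
  exact hF.norm_logDeriv_term_le hinfty hq0 hq1.le hq haF hbF hz hd0 hdr hm δ.1.2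
    (by simpa using δ.2)
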